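/- A finite family of lines in $\mathbb R^2$ is in general position if no three of the lines are concurrent, no two are parallel, and none is vertical. A finite family of lines defines a $k$-cell if some connected component $P$ of the complement of the union of the lines has the property that the boundary of $P$ contains a (nondegenerate) segment from exactly $k$ of the lines. A transversal of families $\mathcal F_1,\dots,\mathcal F_n$ is a set $\{a_1,\dots,a_n\}$ with $a_i\in\mathcal F_i$ for every $i$. **Theorem** (positive-fraction Erdős–Szekeres theorem for lines). For every $n$ there exist a real number $C_n>0$ and an integer $N_n$ such that every finite family $\mathcal F$ of lines in general position in $\mathbb R^2$ with $|\mathcal F|\ge N_n$ contains subfamilies $\mathcal F_1,\dots,\mathcal F_n\subseteq\mathcal F$, each of size at least $C_n|\mathcal F|$, such that every transversal of $\mathcal F_1,\dots,\mathcal F_n$ defines an $n$-cell. -/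

import Mathlib

/-- The Euclidean plane. -/
abbrev Plane : Type := EuclideanSpace ℝ (Fin 2)

/-- A line of the plane is an affine subspace of dimension one. -/
def IsLine (l : AffineSubspace ℝ Plane) : Prop :=
  Module.finrank ℝ l.direction = 1

/-- A line is vertical if its direction contains the vertical unit vector. -/
def IsVertical (l : AffineSubspace ℝ Plane) : Prop :=
  (!₂[(0 : ℝ), 1] : Plane) ∈ l.direction

/-- A finite family of lines in general position: no three lines are concurrent,
no two are parallel, and no line is vertical. -/
structure GeneralPosition (F : Finset (AffineSubspace ℝ Plane)) : Prop where
  isLine : ∀ l ∈ F, IsLine l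
  not_concurrent : ∀ a ∈ F, ∀ b ∈ F, ∀ c ∈ F, a ≠ b → a ≠ c → b ≠ c →
    ¬ ∃ p : Plane, p ∈ a ∧ p ∈ b ∧ p ∈ c
  not_parallel : ∀ a ∈ F, ∀ b ∈ F, a ≠ b → ¬ a.Parallel b
  not_vertical : ∀ l ∈ F, ¬ IsVertical l

/-- The complement of the union of a set of lines. -/
def lineComplement (L : Set (AffineSubspace ℝ Plane)) : Set Plane :=
  {p | ∀ l ∈ L, p ∉ l}

/-- `P` is a connected component of the complement of the union of the lines in `L`. -/
def IsCell (L : Set (AffineSubspace ℝ Plane)) (P : Set Plane) : Prop :=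
  ∃ p ∈ lineComplement L, P = connectedComponentIn (lineComplement L) p

/-- The boundary of `P` contains a (nondegenerate) segment from the line `l`. -/
def BoundaryHasSegment (P : Set Plane) (l : AffineSubspace ℝ Plane) : Prop :=
  ∃ x y : Plane, x ≠ y ∧ segment ℝ x y ⊆ frontier P ∩ (l : Set Plane)

/-- `L` defines a `k`-cell: some connected component of the complement of the union of the lines
in `L` has a boundary that contains a segment from exactly `k` of the lines. -/
def DefinesCell (L : Set (AffineSubspace ℝ Plane)) (k : ℕ) : Prop :=
  ∃ P : Set Plane, IsCell L P ∧ {l | l ∈ L ∧ BoundaryHasSegment P l}.encard = (k : ℕ∞)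

/-- A transversal of families `G 0, …, G (n - 1)`: a set `{a 0, …, a (n - 1)}` with `a i ∈ G i`. -/
def IsTransversal {n : ℕ} (G : Fin n → Finset (AffineSubspace ℝ Plane))
    (T : Set (AffineSubspace ℝ Plane)) : Prop :=
  ∃ a : Fin n → AffineSubspace ℝ Plane, (∀ i, a i ∈ G i) ∧ T = Set.range a

/-!
A line `y = m x + b` is encoded by its slope and intercept. If `n` lines can be ordered by slope so
that each of them is, at some abscissa, strictly above all the others, then the region above all of
them is a convex cell with a segment of each line on its boundary (`definesCell_of_envelope`).
A half turn of the plane gives the same for the region below. By transitivity it is enough to know,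
for consecutive lines `i, j, k` in the order of slopes, that `j` is somewhere above `i` and `k`
(`IsPeak`), provided that the sequence is prolonged by one line at each end
(`exists_forall_lt_of_isPeak`).

Three families of lines, separated by slope, contain subfamilies of a fixed positive fraction such
that either all their triples have a peak or all have a valley (`exists_homogeneous_subsets`).
Indeed, a level of the first family crosses the same level of the third, by the intermediate value
theorem. A positive fraction of the second family lies strictly on one side of the crossing point,
while positive fractions of the first and third lie on the opposite side.

Cutting the given family into many blocks, consecutive in the order of slopes, and thinning them out
for every triple of blocks (`exists_homogeneous_family`) makes all triples of blocks homogeneous, at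
the price of a constant factor. The Erdős–Szekeres argument, in the form of a colouring of pairs
(`exists_hasMonotonePath`), then yields a sequence of `n + 2` blocks all of whose consecutive triples
are of the same kind, and the middle `n` blocks are the required subfamilies.
-/

/-! ### Monotone paths in colourings of triples -/

/-- `HasMonotonePath R r i j`: there are `r + 2` indices, increasing and ending with `i < j`, all of
whose `r` consecutive triples satisfy `R`. -/
def HasMonotonePath (R : ℕ → ℕ → ℕ → Prop) : ℕ → ℕ → ℕ → Prop
  | 0, i, j => i < j
  | r + 1, j, k => j < k ∧ ∃ i, HasMonotonePath R r i j ∧ R i j k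

theorem HasMonotonePath.exists_seq {R : ℕ → ℕ → ℕ → Prop} {r i j : ℕ}
    (h : HasMonotonePath R r i j) :
    ∃ p : ℕ → ℕ, p r = i ∧ p (r + 1) = j ∧ (∀ t ≤ r, p t < p (t + 1)) ∧
      ∀ t < r, R (p t) (p (t + 1)) (p (t + 2)) := by
  induction r generalizing i j with
  | zero =>
    refine ⟨fun t => if t = 0 then i else j, by simp, by simp, ?_, by simp⟩
    intro t ht
    obtain rfl : t = 0 := by omega
    simpa [HasMonotonePath] using h
  | succ r ih =>
    obtain ⟨hij, i', hp, hR⟩ := h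
    obtain ⟨p, h0, h1, h2, h3⟩ := ih hp
    refine ⟨fun t => if t ≤ r + 1 then p t else j, by simp [h1], by simp, ?_, ?_⟩
    · intro t ht
      rcases Nat.lt_or_ge t (r + 1) with ht' | ht'
      · simpa [ht, ht', Nat.succ_le_of_lt ht'] using h2 t (by omega)
      · obtain rfl : t = r + 1 := by omega
        simpa [h1] using hij
    · intro t ht
      rcases Nat.lt_or_ge t r with ht' | ht'
      · have e1 : t ≤ r + 1 := by omega
        have e2 : t + 1 ≤ r + 1 := by omega
        have e3 : t + 2 ≤ r + 1 := by omega
        simpa only [e1, e2, e3, if_true] using h3 t ht'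
      · obtain rfl : t = r := by omega
        simpa [h0, h1] using hR

/-- Colour the pair `i < j` by the lengths of the longest `U`-path and the longest `D`-path ending
in it. In a chain `i < j < k` the pairs `i, j` and `j, k` have different colours, so the sets of
colours of the pairs starting at the various indices are distinct. -/
theorem exists_hasMonotonePath (U D : ℕ → ℕ → ℕ → Prop) (r M : ℕ) (hM : 2 ^ (r * r) < M)
    (hUD : ∀ i j k, i < j → j < k → k < M → U i j k ∨ D i j k) :
    ∃ i j, j < M ∧ (HasMonotonePath U r i j ∨ HasMonotonePath D r i j) := by
  classical
  by_contra! hno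
  let len : (ℕ → ℕ → ℕ → Prop) → ℕ → ℕ → ℕ :=
    fun R i j => Nat.findGreatest (fun t => HasMonotonePath R t i j) r
  have len_spec : ∀ R i j, i < j → HasMonotonePath R (len R i j) i j := fun R i j hij =>
    Nat.findGreatest_spec (P := fun t => HasMonotonePath R t i j) (Nat.zero_le r) hij
  have len_lt : ∀ R i j, i < j → ¬ HasMonotonePath R r i j → len R i j < r := by
    intro R i j hij h
    refine lt_of_le_of_ne (Nat.findGreatest_le r) fun he => h ?_
    have := len_spec R i j hij
    rwa [he] at this
  have len_succ : ∀ R i j k, i < j → j < k → len R i j < r → R i j k →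
      len R i j < len R j k := fun R i j k hij hjk hlt hR =>
    Nat.le_findGreatest (P := fun t => HasMonotonePath R t j k) hlt
      ⟨hjk, i, len_spec R i j hij, hR⟩
  let colours : ℕ → Finset (ℕ × ℕ) := fun i =>
    ((Finset.range M).filter (i < ·)).image fun j => (len U i j, len D i j)
  obtain ⟨i, hi, j, hj, hne, heq⟩ :=
    Finset.exists_ne_map_eq_of_card_lt_of_maps_to
      (s := Finset.range M) (t := (Finset.range r ×ˢ Finset.range r).powerset) (f := colours)
      (by simpa using hM) (by
        intro i _
        simp only [Finset.coe_powerset, Set.mem_preimage, Set.mem_powerset_iff, Finset.coe_subset]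
        intro c hc
        obtain ⟨j, hj, rfl⟩ := Finset.mem_image.1 hc
        obtain ⟨hjM, hij⟩ := Finset.mem_filter.1 hj
        have h := hno i j (Finset.mem_range.1 hjM)
        exact Finset.mem_product.2 ⟨Finset.mem_range.2 (len_lt U i j hij h.1),
          Finset.mem_range.2 (len_lt D i j hij h.2)⟩)
  wlog hij : i < j generalizing i j
  · exact this j hj i hi hne.symm heq.symm (by omega)
  have hjM := Finset.mem_range.1 hj
  have hmem : (len U i j, len D i j) ∈ colours j := by
    rw [← heq]
    exact Finset.mem_image.2 ⟨j, Finset.mem_filter.2 ⟨hj, hij⟩, rfl⟩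
  obtain ⟨k, hk, hc⟩ := Finset.mem_image.1 hmem
  obtain ⟨hkM, hjk⟩ := Finset.mem_filter.1 hk
  obtain ⟨hcU, hcD⟩ := Prod.mk.inj hc
  have h := hno i j hjM
  rcases hUD i j k hij hjk (Finset.mem_range.1 hkM) with hU | hD
  · exact absurd (len_succ U i j k hij hjk (len_lt U i j hij h.1) hU) (by omega)
  · exact absurd (len_succ D i j k hij hjk (len_lt D i j hij h.2) hD) (by omega)

/-! ### Blocks of consecutive elements -/

theorem exists_lower_subset {α : Type*} (m : α → ℝ) (F : Finset α) (q : ℕ) (hq : q ≤ F.card) :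
    ∃ S ⊆ F, S.card = q ∧ ∀ a ∈ S, ∀ c ∈ F, c ∉ S → m a ≤ m c := by
  classical
  induction q with
  | zero => exact ⟨∅, by simp, by simp, by simp⟩
  | succ q ih =>
    obtain ⟨S, hSF, hS, hlow⟩ := ih (by omega)
    have hne : (F \ S).Nonempty := by
      rw [← Finset.card_pos, Finset.card_sdiff_of_subset hSF]
      omega
    obtain ⟨a, ha, hmin⟩ := Finset.exists_min_image (F \ S) m hne
    obtain ⟨haF, haS⟩ := Finset.mem_sdiff.1 ha
    refine ⟨insert a S, Finset.insert_subset haF hSF, by simp [haS, hS], ?_⟩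
    intro x hx c hc hcS
    rw [Finset.mem_insert, not_or] at hcS
    rcases Finset.mem_insert.1 hx with rfl | hx
    · exact hmin c (Finset.mem_sdiff.2 ⟨hc, hcS.2⟩)
    · exact hlow x hx c hc hcS.2

/-- A set on which `m` is injective contains `M` blocks of size `q` that are consecutive with
respect to `m`. -/
theorem exists_blocks {α : Type*} (m : α → ℝ) (q M : ℕ) (F : Finset α)
    (hm : Set.InjOn m F) (hq : M * q ≤ F.card) :
    ∃ Y : ℕ → Finset α, (∀ i, Y i ⊆ F) ∧ (∀ i < M, (Y i).card = q) ∧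
      ∀ i j, i < j → j < M → ∀ a ∈ Y i, ∀ c ∈ Y j, m a < m c := by
  classical
  induction M generalizing F with
  | zero => exact ⟨fun _ => ∅, by simp, by simp, by simp⟩
  | succ M ih =>
    obtain ⟨S, hSF, hS, hlow⟩ := exists_lower_subset m F q (by nlinarith)
    have hsub : F \ S ⊆ F := Finset.sdiff_subset
    obtain ⟨Y, hYF, hY, hlt⟩ := ih (F \ S) (hm.mono (by exact_mod_cast hsub)) (by
      rw [Finset.card_sdiff_of_subset hSF, hS]
      rw [Nat.succ_mul] at hq
      omega)
    refine ⟨fun i => Nat.casesOn i S Y, ?_, ?_, ?_⟩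
    · rintro (_ | i)
      · exact hSF
      · exact (hYF i).trans hsub
    · rintro (_ | i) hi
      · exact hS
      · exact hY i (by omega)
    · rintro (_ | i) (_ | j) hij hj a ha c hc
      · omega
      · obtain ⟨hcF, hcS⟩ := Finset.mem_sdiff.1 (hYF j hc)
        refine lt_of_le_of_ne (hlow a ha c hcF hcS) fun he => hcS ?_
        rwa [← hm (hSF ha) hcF he]
      · omega
      · exact hlt i j (by omega) (by omega) a ha c hc

/-! ### Homogeneous subfamilies of lines -/

/-- The `k`-th level of a finite family of continuous functions, counted from above: the
pointwise maximum, over the subfamilies of size `k`, of the minimum of the subfamily. -/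
theorem exists_continuous_level {α : Type*} (A : Finset α) (f : α → ℝ → ℝ)
    (hf : ∀ a, Continuous (f a)) (k : ℕ) (hk : 1 ≤ k) (hkA : k ≤ A.card) :
    ∃ g : ℝ → ℝ, Continuous g ∧ (∀ x, k ≤ (A.filter fun a => g x ≤ f a x).card) ∧
      ∀ x, A.card < (A.filter fun a => f a x ≤ g x).card + k := by
  classical
  have hne : (A.powersetCard k).Nonempty := Finset.powersetCard_nonempty.2 hkA
  have hne' : ∀ S : {S // S ∈ A.powersetCard k}, S.1.Nonempty := fun S =>
    Finset.card_pos.1 (by rw [(Finset.mem_powersetCard.1 S.2).2]; omega)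
  have hatt : (A.powersetCard k).attach.Nonempty := hne.attach
  refine ⟨fun x => (A.powersetCard k).attach.sup' hatt fun S => S.1.inf' (hne' S) fun a => f a x,
    ?_, ?_, ?_⟩
  · exact Continuous.finset_sup'_apply _ fun S _ => Continuous.finset_inf'_apply _ fun a _ => hf a
  · intro x
    obtain ⟨S, -, hS⟩ := Finset.exists_mem_eq_sup' hatt
      fun S : {S // S ∈ A.powersetCard k} => S.1.inf' (hne' S) fun a => f a x
    obtain ⟨hSA, hSk⟩ := Finset.mem_powersetCard.1 S.2
    refine hSk.symm.le.trans (Finset.card_le_card fun a ha => Finset.mem_filter.2 ⟨hSA ha, ?_⟩)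
    dsimp only
    rw [hS]
    exact Finset.inf'_le _ ha
  · intro x
    set y := (A.powersetCard k).attach.sup' hatt fun S => S.1.inf' (hne' S) fun a => f a x
    change A.card < (A.filter fun a => f a x ≤ y).card + k
    by_contra! hcon
    have hsplit := Finset.card_filter_add_card_filter_not (s := A) (fun a => f a x ≤ y)
    -- Otherwise `k` functions exceed the level strictly, and so does their minimum.
    obtain ⟨S, hS, hSk⟩ := Finset.exists_subset_card_eq
      (s := A.filter fun a => ¬ f a x ≤ y) (n := k) (by omega)
    have hSm : S ∈ A.powersetCard k :=
      Finset.mem_powersetCard.2 ⟨hS.trans (Finset.filter_subset _ _), hSk⟩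
    have hle : S.inf' (hne' ⟨S, hSm⟩) (fun a => f a x) ≤ y :=
      Finset.le_sup' (fun S : {S // S ∈ A.powersetCard k} => S.1.inf' (hne' S) fun a => f a x)
        (Finset.mem_attach _ ⟨S, hSm⟩)
    obtain ⟨a, ha, hae⟩ := Finset.exists_mem_eq_inf' (hne' ⟨S, hSm⟩) fun a => f a x
    rw [hae] at hle
    exact (Finset.mem_filter.1 (hS ha)).2 hle

theorem exists_forall_affine_lt {α : Type*} (m b : α → ℝ) (A B : Finset α)
    (h : ∀ a ∈ A, ∀ c ∈ B, m a < m c) :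
    ∃ x : ℝ, ∀ a ∈ A, ∀ c ∈ B, m a * x + b a < m c * x + b c := by
  have key : ∀ᶠ x : ℝ in Filter.atTop, ∀ a ∈ A, ∀ c ∈ B, m a * x + b a < m c * x + b c := by
    rw [Filter.eventually_all_finset]
    intro a ha
    rw [Filter.eventually_all_finset]
    intro c hc
    filter_upwards [Filter.eventually_gt_atTop ((b a - b c) / (m c - m a))] with x hx
    rw [div_lt_iff₀ (sub_pos.2 (h a ha c hc))] at hx
    linarith
  exact key.exists

/-- With the lines `y = m i * x + b i`, where the slope of `j` lies between those of `i` and `k`: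
at some abscissa the line `j` is above both `i` and `k`. Dually, the points `(m, b)` of the three
lines form a cap. -/
def IsPeak {α : Type*} (m b : α → ℝ) (i j k : α) : Prop :=
  ∃ x : ℝ, m i * x + b i < m j * x + b j ∧ m k * x + b k < m j * x + b j

/-- The level of order `s` of `A₁` meets the one of `A₃` in a point `(x, y)`. At most two lines of
`A₂` pass through it, so at least `s` lines of `A₂` are strictly on one side. These are matched with
the lines of `A₁` and of `A₃` on the other side. Negating the intercepts rotates the plane by a half
turn, so that a peak for `-b` is a point at which the middle line is below the other two. -/
theorem exists_homogeneous_subsets {α : Type*} (m b : α → ℝ) (s : ℕ) (hs : 1 ≤ s)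
    (A₁ A₂ A₃ : Finset α) (h₁ : 4 * s ≤ A₁.card) (h₂ : 4 * s ≤ A₂.card) (h₃ : 4 * s ≤ A₃.card)
    (hlt : ∀ a ∈ A₁, ∀ c ∈ A₃, m a < m c)
    (hconc : ∀ x y : ℝ, (A₂.filter fun a => m a * x + b a = y).card ≤ 2) :
    ∃ B₁ ⊆ A₁, ∃ B₂ ⊆ A₂, ∃ B₃ ⊆ A₃, s ≤ B₁.card ∧ s ≤ B₂.card ∧ s ≤ B₃.card ∧
      ((∀ i ∈ B₁, ∀ j ∈ B₂, ∀ k ∈ B₃, IsPeak m b i j k) ∨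
        (∀ i ∈ B₁, ∀ j ∈ B₂, ∀ k ∈ B₃, IsPeak m (-b) i j k)) := by
  classical
  have hf : ∀ a, Continuous fun x : ℝ => m a * x + b a := fun a => by fun_prop
  obtain ⟨g₁, hg₁, hup₁, hdn₁⟩ :=
    exists_continuous_level A₁ (fun a x => m a * x + b a) hf s hs (by omega)
  obtain ⟨g₃, hg₃, hup₃, hdn₃⟩ :=
    exists_continuous_level A₃ (fun a x => m a * x + b a) hf s hs (by omega)
  have hex : ∀ (A : Finset α) (p : α → Prop) [DecidablePred p], 0 < (A.filter p).card →
      ∃ a ∈ A, p a := fun A p _ h => by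
    obtain ⟨a, ha⟩ := Finset.card_pos.1 h
    exact ⟨a, Finset.mem_filter.1 ha⟩
  obtain ⟨x, hx⟩ : ∃ x, g₃ x - g₁ x = 0 := by
    refine mem_range_of_exists_le_of_exists_ge (hg₃.sub hg₁) ?_ ?_
    · obtain ⟨x, hx⟩ := exists_forall_affine_lt m (-b) A₁ A₃ hlt
      obtain ⟨a, ha, ha'⟩ := hex A₁ _ (lt_of_lt_of_le (by omega)
        (Nat.sub_le_iff_le_add.2 (hdn₁ (-x)).le))
      obtain ⟨c, hc, hc'⟩ := hex A₃ _ (lt_of_lt_of_le hs (hup₃ (-x)))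
      have := hx a ha c hc
      simp only [Pi.neg_apply] at this
      exact ⟨-x, by linarith⟩
    · obtain ⟨x, hx⟩ := exists_forall_affine_lt m b A₁ A₃ hlt
      obtain ⟨a, ha, ha'⟩ := hex A₁ _ (lt_of_lt_of_le hs (hup₁ x))
      obtain ⟨c, hc, hc'⟩ := hex A₃ _ (lt_of_lt_of_le (by omega)
        (Nat.sub_le_iff_le_add.2 (hdn₃ x).le))
      have := hx a ha c hc
      exact ⟨x, by linarith⟩
  have hx' : g₃ x = g₁ x := by linarith
  have hu₁ := hup₁ x
  have hd₁ := hdn₁ x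
  have hu₃ := hup₃ x
  have hd₃ := hdn₃ x
  rw [hx'] at hu₃ hd₃
  generalize g₁ x = y at hu₁ hd₁ hu₃ hd₃
  have hcover : A₂.card ≤ (A₂.filter fun a => y < m a * x + b a).card +
      (A₂.filter fun a => m a * x + b a < y).card +
      (A₂.filter fun a => m a * x + b a = y).card := by
    refine (Finset.card_le_card ?_).trans
      ((Finset.card_union_le _ _).trans (Nat.add_le_add_right (Finset.card_union_le _ _) _))
    intro a ha
    simp only [Finset.mem_union, Finset.mem_filter, ha, true_and]
    rcases lt_trichotomy (m a * x + b a) y with h | h | h <;> tauto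
  have h2 := hconc x y
  rcases Nat.lt_or_ge (A₂.filter fun a => y < m a * x + b a).card s with hcase | hcase
  · refine ⟨_, Finset.filter_subset _ _, A₂.filter fun a => m a * x + b a < y,
      Finset.filter_subset _ _, _, Finset.filter_subset _ _, hu₁, by omega, hu₃, Or.inr ?_⟩
    intro i hi j hj k hk
    have hi := (Finset.mem_filter.1 hi).2
    have hj := (Finset.mem_filter.1 hj).2
    have hk := (Finset.mem_filter.1 hk).2
    refine ⟨-x, ?_, ?_⟩ <;> simp only [Pi.neg_apply] <;> linarith
  · refine ⟨A₁.filter fun a => m a * x + b a ≤ y, Finset.filter_subset _ _, _,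
      Finset.filter_subset _ _, A₃.filter fun a => m a * x + b a ≤ y,
      Finset.filter_subset _ _, by omega, hcase, by omega, Or.inl ?_⟩
    intro i hi j hj k hk
    have hi := (Finset.mem_filter.1 hi).2
    have hj := (Finset.mem_filter.1 hj).2
    have hk := (Finset.mem_filter.1 hk).2
    exact ⟨x, by linarith, by linarith⟩

theorem exists_homogeneous_family {α : Type*} (m b : α → ℝ) (F : Finset α)
    (hconc : ∀ x y : ℝ, (F.filter fun a => m a * x + b a = y).card ≤ 2) (M : ℕ)
    (T : Finset (ℕ × ℕ × ℕ))
    (hT : ∀ t ∈ T, t.1 < t.2.1 ∧ t.2.1 < t.2.2 ∧ t.2.2 < M) (s : ℕ) (hs : 1 ≤ s)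
    (Y : ℕ → Finset α) (hYF : ∀ i, Y i ⊆ F) (hY : ∀ i < M, 4 ^ T.card * s ≤ (Y i).card)
    (hlt : ∀ i j, i < j → j < M → ∀ a ∈ Y i, ∀ c ∈ Y j, m a < m c) :
    ∃ Z : ℕ → Finset α, (∀ i, Z i ⊆ Y i) ∧ (∀ i < M, s ≤ (Z i).card) ∧
      ∀ t ∈ T,
        (∀ i ∈ Z t.1, ∀ j ∈ Z t.2.1, ∀ k ∈ Z t.2.2, IsPeak m b i j k) ∨
        (∀ i ∈ Z t.1, ∀ j ∈ Z t.2.1, ∀ k ∈ Z t.2.2, IsPeak m (-b) i j k) := by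
  classical
  induction T using Finset.induction_on generalizing s with
  | empty => exact ⟨Y, fun _ => subset_rfl, by simpa using hY, by simp⟩
  | insert t T ht ih =>
    rw [Finset.card_insert_of_notMem ht] at hY
    obtain ⟨Z, hZY, hZ, hhom⟩ := ih (fun t' ht' => hT t' (Finset.mem_insert_of_mem ht')) (4 * s)
      (by omega) (fun i hi => by have := hY i hi; rw [pow_succ] at this; rwa [← mul_assoc])
    obtain ⟨i, j, k⟩ := t
    obtain ⟨hij, hjk, hkM⟩ := hT (i, j, k) (Finset.mem_insert_self _ _)
    dsimp only at hij hjk hkM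
    obtain ⟨B₁, hB₁, B₂, hB₂, B₃, hB₃, hc₁, hc₂, hc₃, hB⟩ :=
      exists_homogeneous_subsets m b s hs (Z i) (Z j) (Z k) (hZ i (by omega)) (hZ j (by omega))
        (hZ k hkM)
        (fun a ha c hc => hlt i k (by omega) hkM a (hZY i ha) c (hZY k hc))
        (fun x y => (Finset.card_le_card (Finset.filter_subset_filter _
          ((hZY j).trans (hYF j)))).trans (hconc x y))
    let W : ℕ → Finset α := fun l => if l = i then B₁ else if l = j then B₂ else
      if l = k then B₃ else Z l
    have hWi : W i = B₁ := if_pos rfl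
    have hWj : W j = B₂ := by simp [W, hij.ne']
    have hWk : W k = B₃ := by simp [W, hjk.ne', (hij.trans hjk).ne']
    have hWo : ∀ l, l ≠ i → l ≠ j → l ≠ k → W l = Z l := fun l h1 h2 h3 => by simp [W, h1, h2, h3]
    have hWZ : ∀ l, W l ⊆ Z l := by
      intro l
      by_cases h1 : l = i
      · subst h1; rwa [hWi]
      by_cases h2 : l = j
      · subst h2; rwa [hWj]
      by_cases h3 : l = k
      · subst h3; rwa [hWk]
      rw [hWo l h1 h2 h3]
    refine ⟨W, fun l => (hWZ l).trans (hZY l), ?_, ?_⟩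
    · intro l hl
      by_cases h1 : l = i
      · subst h1; rwa [hWi]
      by_cases h2 : l = j
      · subst h2; rwa [hWj]
      by_cases h3 : l = k
      · subst h3; rwa [hWk]
      rw [hWo l h1 h2 h3]
      have := hZ l hl
      omega
    · intro t' ht'
      rcases Finset.mem_insert.1 ht' with rfl | ht'
      · simpa only [hWi, hWj, hWk] using hB
      · exact (hhom t' ht').imp
          (fun h a ha c hc d hd => h a (hWZ _ ha) c (hWZ _ hc) d (hWZ _ hd))
          (fun h a ha c hc d hd => h a (hWZ _ ha) c (hWZ _ hc) d (hWZ _ hd))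

/-! ### Envelopes -/

/-- If the slopes increase and consecutive triples have peaks, at abscissae `x 0, x 1, …`, then
these abscissae increase, and at `x i` the values increase up to the line `i + 1` and
decrease from there on. -/
theorem exists_forall_lt_of_isPeak {n : ℕ} (m b : ℕ → ℝ)
    (hm : ∀ i ≤ n, m i < m (i + 1))
    (hp : ∀ i < n, IsPeak m b i (i + 1) (i + 2)) (i : ℕ) (hi : i < n) :
    ∃ x : ℝ, ∀ j < n, j ≠ i → m (j + 1) * x + b (j + 1) < m (i + 1) * x + b (i + 1) := by
  choose! x hx1 hx2 using hp
  have hxs : ∀ j, j + 1 < n → x j < x (j + 1) := by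
    intro j hj
    have h1 := hx2 j (by omega)
    have h2 := hx1 (j + 1) hj
    have h3 := hm (j + 1) (by omega)
    rw [show j + 1 + 1 = j + 2 from rfl] at *
    by_contra! hle
    nlinarith
  have hxm : ∀ j d, j + d < n → x j ≤ x (j + d) := by
    intro j d
    induction d with
    | zero => simp
    | succ d ih => intro h; exact (ih (by omega)).trans (hxs (j + d) h).le
  refine ⟨x i, ?_⟩
  have hdown : ∀ d, d < i → m (i - d) * x i + b (i - d) < m (i + 1) * x i + b (i + 1) := by
    intro d
    induction d with
    | zero => intro _; exact hx1 i hi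
    | succ d ih =>
      intro hd
      obtain ⟨e, he⟩ : ∃ e, i = e + (d + 1) := ⟨i - (d + 1), by omega⟩
      refine lt_trans ?_ (ih (by omega))
      have e1 : i - (d + 1) = e := by omega
      have e2 : i - d = e + 1 := by omega
      rw [e1, e2]
      have h1 := hx1 e (by omega)
      have h2 := hxm e (d + 1) (by omega)
      rw [← he] at h2
      have h3 := hm e (by omega)
      nlinarith
  have hup : ∀ d, i + d < n → m (i + d + 2) * x i + b (i + d + 2) <
      m (i + 1) * x i + b (i + 1) := by
    intro d
    induction d with
    | zero => intro _; exact hx2 i hi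
    | succ d ih =>
      intro hd
      refine lt_trans ?_ (ih (by omega))
      have h1 := hx2 (i + (d + 1)) hd
      have h2 := hxm i (d + 1) hd
      have h3 := hm (i + (d + 1) + 1) (by omega)
      rw [show i + (d + 1) + 1 + 1 = i + (d + 1) + 2 from rfl] at h3
      rw [show i + d + 2 = i + (d + 1) + 1 by omega]
      nlinarith
  intro j hj hji
  rcases Nat.lt_or_ge j i with h | h
  · have := hdown (i - (j + 1)) (by omega)
    rwa [show i - (i - (j + 1)) = j + 1 by omega] at this
  · have := hup (j - (i + 1)) (by omega)
    rwa [show i + (j - (i + 1)) + 2 = j + 1 by omega] at this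

/-! ### Lines of the plane and cells of their arrangements -/

theorem exists_slope_intercept {l : AffineSubspace ℝ Plane} (hl : IsLine l)
    (hv : ¬ IsVertical l) : ∃ m b : ℝ, ∀ p : Plane, p ∈ l ↔ p 1 = m * p 0 + b := by
  obtain ⟨⟨v, hv1⟩, hv0, hspan⟩ := finrank_eq_one_iff'.1 hl
  have hne : (l : Set Plane).Nonempty := by
    rw [Set.nonempty_iff_ne_empty]
    intro h
    obtain rfl : l = ⊥ := by simpa using h
    rw [IsLine, AffineSubspace.direction_bot, finrank_bot] at hl
    exact zero_ne_one hl
  obtain ⟨q, hq⟩ := hne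
  have hv00 : v 0 ≠ 0 := by
    intro h0
    apply hv
    have h1 : v 1 ≠ 0 := by
      intro h1
      apply hv0
      ext i
      fin_cases i <;> simp [h0, h1]
    have : (!₂[(0 : ℝ), 1] : Plane) = (v 1)⁻¹ • v := by
      ext i
      fin_cases i <;> simp [h0, h1]
    unfold IsVertical
    rw [this]
    exact Submodule.smul_mem _ _ hv1
  refine ⟨v 1 / v 0, q 1 - v 1 / v 0 * q 0, fun p => ?_⟩
  have hpq : p ∈ l ↔ p - q ∈ l.direction := by
    rw [← vsub_eq_sub, AffineSubspace.vsub_right_mem_direction_iff_mem hq]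
  rw [hpq]
  constructor
  · intro h
    obtain ⟨c, hc⟩ := hspan ⟨p - q, h⟩
    have hc := congrArg Subtype.val hc
    have h0 := congrArg (fun w : Plane => w 0) hc
    have h1 := congrArg (fun w : Plane => w 1) hc
    simp at h0 h1
    field_simp
    linear_combination v 1 * h0 - v 0 * h1
  · intro h
    have : p - q = ((p 0 - q 0) / v 0) • v := by
      ext i
      fin_cases i
      · simp; field_simp
      · simp; rw [h]; field_simp; ring
    rw [this]
    exact Submodule.smul_mem _ _ hv1

/-- Lines with the same slope are translates of each other. -/
theorem parallel_of_slope_eq {l l' : AffineSubspace ℝ Plane} {m b b' : ℝ}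
    (hl : ∀ p : Plane, p ∈ l ↔ p 1 = m * p 0 + b)
    (hl' : ∀ p : Plane, p ∈ l' ↔ p 1 = m * p 0 + b') : l.Parallel l' := by
  refine ⟨!₂[0, b' - b], ?_⟩
  ext p
  rw [hl', AffineSubspace.mem_map]
  constructor
  · intro h
    refine ⟨p - !₂[0, b' - b], ?_, by simp⟩
    rw [hl]
    simp
    linarith
  · rintro ⟨q, hq, rfl⟩
    rw [hl] at hq
    simp
    linarith

/-- For `ε = 1`: if each line is, at some abscissa, strictly above all others, then the region above
all lines is a cell that has all of them on its boundary. For `ε = -1` the inequality says that the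
line `i` is strictly below the others at the abscissa `-x`, and the cell is the region below all
lines. -/
theorem definesCell_of_envelope {n : ℕ} (a : Fin n → AffineSubspace ℝ Plane) (m b : Fin n → ℝ)
    (ha : ∀ i (p : Plane), p ∈ a i ↔ p 1 = m i * p 0 + b i) (ε : ℝ) (hε : ε * ε = 1)
    (h : ∀ i, ∃ x : ℝ, ∀ j, j ≠ i → m j * x + ε * b j < m i * x + ε * b i) :
    DefinesCell (Set.range a) n := by
  have hε0 : ε ≠ 0 := by rintro rfl; simp at hε
  -- `ε` times the height of `p` above the line `i`.
  let gap : Fin n → Plane → ℝ := fun i p => ε * p 1 - (m i * (ε * p 0) + ε * b i)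
  have hgap : ∀ i, Continuous (gap i) := fun i => by fun_prop
  have gap_eq : ∀ i p, p ∈ a i ↔ gap i p = 0 := by
    intro i p
    rw [ha, show gap i p = ε * (p 1 - (m i * p 0 + b i)) by simp only [gap]; ring]
    simp [hε0, sub_eq_zero]
  have gap_comb : ∀ (s t : ℝ), s + t = 1 → ∀ i p q,
      gap i (s • p + t • q) = s * gap i p + t * gap i q := by
    intro s t hst i p q
    simp only [gap, PiLp.add_apply, PiLp.smul_apply, smul_eq_mul]
    linear_combination ε * b i * hst
  let P : Set Plane := {p | ∀ i, 0 < gap i p}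
  have hPopen : IsOpen P := by
    have : P = ⋂ i, {p | 0 < gap i p} := by ext; simp [P]
    rw [this]
    exact isOpen_iInter_of_finite fun i => isOpen_lt continuous_const (hgap i)
  have hPconv : Convex ℝ P := by
    intro p hp q hq s t hs ht hst i
    rw [gap_comb s t hst]
    have h1 := hp i
    have h2 := hq i
    rcases hs.eq_or_lt with rfl | hs'
    · have : t = 1 := by linarith
      subst this; linarith
    · have := mul_pos hs' h1
      have := mul_nonneg ht h2.le
      linarith
  have hPsub : P ⊆ lineComplement (Set.range a) := by
    rintro p hp _ ⟨i, rfl⟩ hi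
    exact (hp i).ne' ((gap_eq i p).1 hi)
  have hPne : P.Nonempty := by
    obtain ⟨t, ht⟩ := (Set.finite_range fun i => ε * b i).bddAbove
    refine ⟨!₂[0, ε * (t + 1)], fun i => ?_⟩
    have := ht ⟨i, rfl⟩
    have e : ε * (ε * (t + 1)) = t + 1 := by rw [← mul_assoc, hε, one_mul]
    simp only [gap]
    simp [e]
    linarith
  have hcell : IsCell (Set.range a) P := by
    obtain ⟨p, hp⟩ := hPne
    refine ⟨p, hPsub hp, (hPconv.isPreconnected.subset_connectedComponentIn hp hPsub).antisymm ?_⟩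
    have hQ : IsOpen (⋃ i, {p | gap i p < 0}) :=
      isOpen_iUnion fun i => isOpen_lt (hgap i) continuous_const
    refine isPreconnected_connectedComponentIn.subset_left_of_subset_union hPopen hQ ?_ ?_
      ⟨p, mem_connectedComponentIn (hPsub hp), hp⟩
    · rw [Set.disjoint_left]
      intro q hq hq'
      obtain ⟨i, hi⟩ := Set.mem_iUnion.1 hq'
      exact lt_asymm (hq i) hi
    · intro q hq
      have hq := connectedComponentIn_subset _ _ hq
      by_cases hqP : q ∈ P
      · exact Or.inl hqP
      · right
        simp only [P, Set.mem_ofPred_eq, not_forall, not_lt] at hqP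
        obtain ⟨i, hi⟩ := hqP
        exact Set.mem_iUnion.2 ⟨i, lt_of_le_of_ne hi fun h0 => hq _ ⟨i, rfl⟩ ((gap_eq i q).2 h0)⟩
  -- A point of the line `i` on or above the other lines is a limit of points of `P`.
  have hfront : ∀ i p, gap i p = 0 → (∀ j, 0 ≤ gap j p) → p ∈ frontier P := by
    intro i p hi hall
    rw [frontier, hPopen.interior_eq]
    refine ⟨?_, fun hp => (hp i).ne' hi⟩
    have hlim : Filter.Tendsto (fun t : ℝ => p + t • (!₂[0, ε] : Plane))
        (nhdsWithin 0 (Set.Ioi 0)) (nhds p) := by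
      have : Continuous (fun t : ℝ => p + t • (!₂[0, ε] : Plane)) := by fun_prop
      simpa using (this.tendsto 0).mono_left nhdsWithin_le_nhds
    refine mem_closure_of_tendsto hlim ?_
    filter_upwards [self_mem_nhdsWithin] with t ht j
    have ht : 0 < t := ht
    have e : gap j (p + t • (!₂[0, ε] : Plane)) = gap j p + t := by
      simp [gap]
      linear_combination t * hε
    rw [e]
    linarith [hall j]
  have hinj : Function.Injective a := by
    intro i j hij
    by_contra hne
    obtain ⟨x, hx⟩ := h i
    have h1 := hx j (Ne.symm hne)
    have hp : (!₂[ε * x, m i * (ε * x) + b i] : Plane) ∈ a i := (ha i _).2 (by simp)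
    rw [hij, ha] at hp
    simp at hp
    have : ε * (m i * (ε * x) + b i) = ε * (m j * (ε * x) + b j) := by rw [hp]
    have : m i * x + ε * b i = m j * x + ε * b j := by
      linear_combination this + (m j - m i) * x * hε
    linarith
  refine ⟨P, hcell, ?_⟩
  have hall : {l | l ∈ Set.range a ∧ BoundaryHasSegment P l} = Set.range a := by
    refine Set.Subset.antisymm (fun l hl => hl.1) ?_
    rintro _ ⟨i, rfl⟩
    refine ⟨⟨i, rfl⟩, ?_⟩
    obtain ⟨x, hx⟩ := h i
    -- The line `i` is above the others near `x` too, in particular at some `z > x`.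
    have hnear : ∀ᶠ z in nhdsWithin x (Set.Ioi x),
        ∀ j, j ≠ i → m j * z + ε * b j < m i * z + ε * b i := by
      refine Filter.Eventually.filter_mono nhdsWithin_le_nhds ?_
      rw [Filter.eventually_all]
      intro j
      by_cases hj : j = i
      · simp [hj]
      · have hc : ∀ k, Continuous fun z : ℝ => m k * z + ε * b k := fun k => by fun_prop
        filter_upwards [(isOpen_lt (hc j) (hc i)).mem_nhds (hx j hj)] with z hz _ using hz
    obtain ⟨z, hz, hxz⟩ := (hnear.and self_mem_nhdsWithin).exists
    have hxz : x < z := hxz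
    let pt : ℝ → Plane := fun w => !₂[ε * w, m i * (ε * w) + b i]
    have hgpt : ∀ j w, gap j (pt w) = (m i * w + ε * b i) - (m j * w + ε * b j) := by
      intro j w
      simp [gap, pt]
      linear_combination (m i - m j) * w * hε
    refine ⟨pt x, pt z, ?_, ?_⟩
    · intro he
      have := congrArg (fun w : Plane => w 0) he
      simp [pt, hε0] at this
      exact hxz.ne this
    · rintro _ ⟨s, t, hs, ht, hst, rfl⟩
      have hg := fun j => gap_comb s t hst j (pt x) (pt z)
      have hi0 : gap i (s • pt x + t • pt z) = 0 := by rw [hg, hgpt, hgpt]; ring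
      refine ⟨hfront i _ hi0 fun j => ?_, (gap_eq i _).2 hi0⟩
      rw [hg, hgpt, hgpt]
      by_cases hj : j = i
      · subst hj; simp
      · have h1 := hx j hj
        have h2 := hz j hj
        exact add_nonneg (mul_nonneg hs (by linarith)) (mul_nonneg ht (by linarith))
  rw [hall, ← Set.image_univ, hinj.encard_image, Set.encard_univ]
  simp

/-! ### The positive-fraction theorem -/

theorem mainTheorem4 (n : ℕ) :
    ∃ C : ℝ, 0 < C ∧ ∃ N : ℕ, ∀ F : Finset (AffineSubspace ℝ Plane),
      GeneralPosition F → N ≤ F.card →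
        ∃ G : Fin n → Finset (AffineSubspace ℝ Plane),
          (∀ i, G i ⊆ F ∧ C * (F.card : ℝ) ≤ ((G i).card : ℝ)) ∧
          ∀ T : Set (AffineSubspace ℝ Plane), IsTransversal G T → DefinesCell T n := by
  classical
  let M := 2 ^ (n * n) + 1
  let T := (Finset.range M ×ˢ Finset.range M ×ˢ Finset.range M).filter
    fun t => t.1 < t.2.1 ∧ t.2.1 < t.2.2
  have hTmem : ∀ i j k, (i, j, k) ∈ T ↔ i < j ∧ j < k ∧ k < M := by
    intro i j k
    simp only [T, Finset.mem_filter, Finset.mem_product, Finset.mem_range]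
    omega
  let K := M * 4 ^ T.card
  have hK : 0 < K := by positivity
  refine ⟨1 / (2 * K), by positivity, K, fun F hF hN => ?_⟩
  have hex : ∀ l : AffineSubspace ℝ Plane, ∃ m b : ℝ, l ∈ F →
      ∀ p : Plane, p ∈ l ↔ p 1 = m * p 0 + b := by
    intro l
    by_cases hl : l ∈ F
    · obtain ⟨m, b, h⟩ := exists_slope_intercept (hF.isLine l hl) (hF.not_vertical l hl)
      exact ⟨m, b, fun _ => h⟩
    · exact ⟨0, 0, fun h => absurd h hl⟩
  choose m b hmb using hex
  have hm : Set.InjOn m F := by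
    intro l hl l' hl' he
    by_contra hne
    refine hF.not_parallel l hl l' hl' hne (parallel_of_slope_eq (b' := b l') (hmb l hl) ?_)
    rw [he]
    exact hmb l' hl'
  have hconc : ∀ x y : ℝ, (F.filter fun a => m a * x + b a = y).card ≤ 2 := by
    intro x y
    by_contra! hcard
    obtain ⟨l₁, l₂, l₃, h₁, h₂, h₃, h12, h13, h23⟩ := Finset.two_lt_card_iff.1 hcard
    rw [Finset.mem_filter] at h₁ h₂ h₃
    refine hF.not_concurrent l₁ h₁.1 l₂ h₂.1 l₃ h₃.1 h12 h13 h23 ⟨!₂[x, y], ?_, ?_, ?_⟩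
    · rw [hmb l₁ h₁.1]; simpa using h₁.2.symm
    · rw [hmb l₂ h₂.1]; simpa using h₂.2.symm
    · rw [hmb l₃ h₃.1]; simpa using h₃.2.symm
  -- Rounding down loses at most a factor of two, as the quotient is at least one.
  let s := F.card / K
  have hs : 1 ≤ s := (Nat.one_le_div_iff hK).2 hN
  have hsF : s * K ≤ F.card := Nat.div_mul_le_self _ _
  have hFs : F.card < (s + 1) * K := by
    rw [mul_comm]; exact Nat.lt_mul_div_succ _ hK
  obtain ⟨Y, hYF, hYc, hYlt⟩ := exists_blocks m (4 ^ T.card * s) M F hm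
    (by rw [← mul_assoc, mul_comm]; exact hsF)
  obtain ⟨Z, hZY, hZc, hZ⟩ := exists_homogeneous_family m b F hconc M T
    (fun t ht => (hTmem t.1 t.2.1 t.2.2).1 ht) s hs Y hYF (fun i hi => (hYc i hi).ge) hYlt
  let H : (AffineSubspace ℝ Plane → ℝ) → ℕ → ℕ → ℕ → Prop := fun b' i j k =>
    ∀ l₁ ∈ Z i, ∀ l₂ ∈ Z j, ∀ l₃ ∈ Z k, IsPeak m b' l₁ l₂ l₃
  obtain ⟨i₀, j₀, hj₀, hpath⟩ := exists_hasMonotonePath (H b) (H (-b)) n M (Nat.lt_succ_self _)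
    (fun i j k hij hjk hk => hZ (i, j, k) ((hTmem i j k).2 ⟨hij, hjk, hk⟩))
  obtain ⟨ε, hε, hpath⟩ : ∃ ε : ℝ, ε * ε = 1 ∧
      HasMonotonePath (H fun l => ε * b l) n i₀ j₀ := by
    rcases hpath with h | h
    · exact ⟨1, by simp, by simpa using h⟩
    · refine ⟨-1, by simp, ?_⟩
      have e : (fun l => -1 * b l) = -b := by ext; simp
      rwa [e]
  obtain ⟨p, -, hpn, hpmono, hpeak⟩ := hpath.exists_seq
  have hpM : ∀ t ≤ n + 1, p t < M := by
    have : ∀ d ≤ n + 1, p (n + 1 - d) ≤ p (n + 1) := by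
      intro d
      induction d with
      | zero => simp
      | succ d ih =>
        intro hd
        have h1 := hpmono (n + 1 - (d + 1)) (by omega)
        rw [show n + 1 - (d + 1) + 1 = n + 1 - d by omega] at h1
        exact h1.le.trans (ih (by omega))
    intro t ht
    have := this (n + 1 - t) (by omega)
    rw [show n + 1 - (n + 1 - t) = t by omega] at this
    omega
  -- The two extreme families of the path only serve to bound the middle `n` ones.
  refine ⟨fun i => Z (p (i + 1)), fun i => ⟨(hZY _).trans (hYF _), ?_⟩, ?_⟩
  · have h1 : s ≤ (Z (p (i + 1))).card := hZc _ (hpM _ (by omega))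
    have h2 : F.card ≤ 2 * K * s := by nlinarith
    have h3 : (F.card : ℝ) ≤ 2 * K * s := by exact_mod_cast h2
    have hK' : (0 : ℝ) < 2 * K := by positivity
    calc 1 / (2 * (K : ℝ)) * F.card ≤ s := by
          rw [one_div, inv_mul_le_iff₀ hK']; exact h3
      _ ≤ _ := by exact_mod_cast h1
  · rintro _ ⟨a, ha, rfl⟩
    have hZne : ∀ t, ∃ l, t ≤ n + 1 → l ∈ Z (p t) := by
      intro t
      by_cases ht : t ≤ n + 1
      · obtain ⟨l, hl⟩ := Finset.card_pos.1 (lt_of_lt_of_le hs (hZc _ (hpM t ht)))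
        exact ⟨l, fun _ => hl⟩
      · exact ⟨⊥, fun h => absurd h ht⟩
    choose z hz using hZne
    let c : ℕ → AffineSubspace ℝ Plane := fun t =>
      if h : 1 ≤ t ∧ t ≤ n then a ⟨t - 1, by omega⟩ else z t
    have hcZ : ∀ t ≤ n + 1, c t ∈ Z (p t) := by
      intro t ht
      by_cases h : 1 ≤ t ∧ t ≤ n
      · have := ha ⟨t - 1, by omega⟩
        simp only [Nat.sub_add_cancel h.1] at this
        simpa only [c, dif_pos h] using this
      · simpa only [c, dif_neg h] using hz t ht
    have hca : ∀ i : Fin n, c (i + 1) = a i := by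
      intro i
      have h : 1 ≤ (i : ℕ) + 1 ∧ (i : ℕ) + 1 ≤ n := by omega
      simp only [c, dif_pos h]
      rfl
    refine definesCell_of_envelope a (fun i => m (a i)) (fun i => b (a i))
      (fun i => hmb _ (hYF _ (hZY _ (ha i)))) ε hε fun i => ?_
    obtain ⟨x, hx⟩ := exists_forall_lt_of_isPeak (n := n) (fun t => m (c t))
      (fun t => ε * b (c t))
      (fun t ht => hYlt _ _ (hpmono t ht) (hpM _ (by omega)) _ (hZY _ (hcZ t (by omega)))
        _ (hZY _ (hcZ (t + 1) (by omega))))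
      (fun t ht => hpeak t ht _ (hcZ t (by omega)) _ (hcZ (t + 1) (by omega)) _
        (hcZ (t + 2) (by omega))) i i.2
    refine ⟨x, fun j hj => ?_⟩
    have := hx j j.2 (fun h => hj (Fin.ext h))
    simpa only [hca] using this
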